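/- For integers $n,d,k\ge 0$, let $F_{n,d}$ denote the vector space of real forms (homogeneous polynomials, including $0$) of degree $d$ in $n$ variables, let $F_{n,d}^k\subset F_{n,d}$ denote the set of those forms having at most $k$ terms (i.e. at most $k$ monomials with nonzero coefficient), and let \[ \Sigma_{n,2d}^k=\Bigl\{\sum_{j=1}^m h_j^2 \ \Big|\ m\in\mathbb N,\ h_j\in F_{n,d}^k\Bigr\}. \] Let $k\ge 1$ and let $h\in F_{n,d}^k\setminus F_{n,d}^{k-1}$, that is, $h$ is a real form of degree $d$ in $n$ variables with exactly $k$ terms. Suppose that either $h$ is indefinite (it takes both positive and negative values on $\mathbb R^n$) and irreducible in $\mathbb R[x_1,\dots,x_n]$, or $h$ is a product of real linear forms. Then \[ h^2\in\Sigma_{n,2d}^k\setminus\Sigma_{n,2d}^{k-1}. \] -/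

import Mathlib

open MvPolynomial

/-- `F_{n,d}`: the real vector space of real forms (homogeneous polynomials) of degree `d` in `n`
variables (together with `0`). -/
abbrev Forms (n d : ℕ) : Submodule ℝ (MvPolynomial (Fin n) ℝ) :=
  homogeneousSubmodule (Fin n) ℝ d

/-- `F_{n,d}^k`: the forms of degree `d` in `n` variables with at most `k` terms. -/
def FormsAtMost (n d k : ℕ) : Set (MvPolynomial (Fin n) ℝ) :=
  {p | p ∈ Forms n d ∧ p.support.card ≤ k}

/-- `Σ_{n,2d}^k`: the finite sums of squares of elements of `F_{n,d}^k`. The argument `d` is the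
degree of the forms that are squared, so the elements have degree `2d`. -/
def SigmaCone (n d k : ℕ) : Set (MvPolynomial (Fin n) ℝ) :=
  {f | ∃ (m : ℕ) (g : Fin m → MvPolynomial (Fin n) ℝ),
    (∀ j, g j ∈ FormsAtMost n d k) ∧ f = ∑ j, g j ^ 2}

/-- A real polynomial is indefinite if it takes both positive and negative values. -/
def IsIndefinite {n : ℕ} (p : MvPolynomial (Fin n) ℝ) : Prop :=
  (∃ x : Fin n → ℝ, 0 < eval x p) ∧ (∃ y : Fin n → ℝ, eval y p < 0)

/-- `p` is a finite product of real linear forms. -/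
def IsProductOfLinearForms {n : ℕ} (p : MvPolynomial (Fin n) ℝ) : Prop :=
  ∃ (m : ℕ) (l : Fin m → MvPolynomial (Fin n) ℝ), (∀ i, l i ∈ Forms n 1) ∧ p = ∏ i, l i

/-! If `h ^ 2` is a sum of squares of forms `g j`, every `g j` vanishes at the real zeros of `h`.
When `h` is irreducible and indefinite, this forces `h ∣ g j` (`IsIndefinite.dvd_of_eval_eq_zero`):
`h` has a zero on every segment near one joining a positive point to a negative one, too many zeros
for a non-multiple of `h` to share. Nonzero linear forms are irreducible and indefinite, so products
of them are handled by cancelling one factor at a time. Since degrees agree, each `g j` is a scalar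
multiple of `h`; having fewer terms, it is zero, so `h = 0`, a contradiction. -/

section Coprime

open Polynomial nonZeroDivisors

/-- An irreducible nonconstant polynomial over a GCD domain that does not divide `q` generates,
together with `q`, an ideal containing a nonzero constant. -/
theorem Polynomial.exists_mul_add_mul_eq_C {R : Type*} [CommRing R] [IsDomain R] [IsGCDMonoid R]
    {p q : R[X]} (hp : Irreducible p) (hdeg : p.natDegree ≠ 0) (hpq : ¬ p ∣ q) :
    ∃ (u v : R[X]) (r : R), r ≠ 0 ∧ u * p + v * q = C r := by
  let K := FractionRing R
  have hprim := hp.isPrimitive hdeg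
  have hirr : Irreducible (p.map (algebraMap R K)) :=
    hprim.irreducible_iff_irreducible_map_fraction_map.1 hp
  have hndvd : ¬ p.map (algebraMap R K) ∣ q.map (algebraMap R K) := fun h =>
    hpq (hprim.dvd_of_fraction_map_dvd_fraction_map h)
  obtain ⟨u, v, huv⟩ := hirr.coprime_iff_not_dvd.2 hndvd
  -- `b` and `c` clear the denominators of the Bézout coefficients over the fraction field.
  obtain ⟨b, hb, hu⟩ := IsLocalization.integerNormalization_spec R⁰ u
  obtain ⟨c, hc, hv⟩ := IsLocalization.integerNormalization_spec R⁰ v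
  refine ⟨C c * IsLocalization.integerNormalization R⁰ u,
    C b * IsLocalization.integerNormalization R⁰ v, b * c,
    mul_ne_zero (nonZeroDivisors.ne_zero hb) (nonZeroDivisors.ne_zero hc), ?_⟩
  apply Polynomial.map_injective _ (FaithfulSMul.algebraMap_injective R K)
  simp only [Polynomial.map_add, Polynomial.map_mul, hu, hv, Polynomial.map_C, map_mul,
    Algebra.smul_def, Polynomial.algebraMap_apply]
  linear_combination (C (algebraMap R K b) * C (algebraMap R K c)) * huv

end Coprime

section Shear

variable {σ : Type*}

/-- The substitution `x ↦ x + t v`, with `t` the variable of the outer polynomial ring. -/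
noncomputable def lineSubst (v : σ → ℝ) :
    MvPolynomial σ ℝ →ₐ[ℝ] Polynomial (MvPolynomial σ ℝ) :=
  aeval fun i => Polynomial.C (X i) + Polynomial.C (C (v i)) * Polynomial.X

/-- The endomorphism of `ℝ[x][t]` with `x ↦ x + t v` and `t ↦ t`. -/
noncomputable def shear (v : σ → ℝ) :
    Polynomial (MvPolynomial σ ℝ) →+* Polynomial (MvPolynomial σ ℝ) :=
  Polynomial.eval₂RingHom (lineSubst v).toRingHom Polynomial.X

theorem shear_C (v : σ → ℝ) (p : MvPolynomial σ ℝ) :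
    shear v (Polynomial.C p) = lineSubst v p := by
  simp [shear]

theorem shear_neg_comp_shear (v : σ → ℝ) :
    (shear (-v)).comp (shear v) = RingHom.id _ := by
  refine Polynomial.ringHom_ext' (MvPolynomial.ringHom_ext (fun r => ?_) fun i => ?_) ?_
  · simp [shear, lineSubst, Polynomial.algebraMap_apply, MvPolynomial.algebraMap_eq]
  · simp [shear, lineSubst, Polynomial.algebraMap_apply, MvPolynomial.algebraMap_eq]
    ring
  · simp [shear]

/-- `shear v` as an automorphism, with inverse `shear (-v)`. -/
noncomputable def shearEquiv (v : σ → ℝ) :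
    Polynomial (MvPolynomial σ ℝ) ≃+* Polynomial (MvPolynomial σ ℝ) :=
  RingEquiv.ofRingHom (shear v) (shear (-v))
    (by simpa using shear_neg_comp_shear (-v)) (shear_neg_comp_shear v)

theorem shearEquiv_C (v : σ → ℝ) (p : MvPolynomial σ ℝ) :
    shearEquiv v (Polynomial.C p) = lineSubst v p :=
  shear_C v p

theorem eval_map_lineSubst (v x : σ → ℝ) (t : ℝ) (p : MvPolynomial σ ℝ) :
    ((lineSubst v p).map (eval x)).eval t = eval (x + t • v) p := by
  have : ((Polynomial.evalRingHom t).comp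
      (Polynomial.mapRingHom (eval x))).comp (lineSubst v).toRingHom = eval (x + t • v) := by
    refine MvPolynomial.ringHom_ext (fun r => ?_) fun i => ?_
    · simp [lineSubst, Polynomial.algebraMap_apply, MvPolynomial.algebraMap_eq]
    · simp [lineSubst]
      ring
  exact congrArg (fun φ => φ p) this

/-- The shear is an automorphism, and a prime `p` stays prime as a constant of `ℝ[x][t]`. -/
theorem lineSubst_irreducible (v : σ → ℝ) {p : MvPolynomial σ ℝ} (hp : Irreducible p) :
    Irreducible (lineSubst v p) := by
  rw [← shearEquiv_C, MulEquiv.irreducible_iff]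
  exact (Polynomial.prime_C_iff.2 hp.prime).irreducible

theorem lineSubst_dvd_iff (v : σ → ℝ) {p q : MvPolynomial σ ℝ} :
    lineSubst v p ∣ lineSubst v q ↔ p ∣ q := by
  rw [← shearEquiv_C, ← shearEquiv_C, map_dvd_iff]
  refine ⟨fun h => ?_, fun h => map_dvd _ h⟩
  -- Setting `t = 0` recovers divisibility in `ℝ[x]`.
  simpa using map_dvd Polynomial.constantCoeff h

end Shear

/-- A polynomial vanishing near a point is zero. -/
theorem MvPolynomial.eq_zero_of_eventually_eval_eq_zero {σ : Type*} [Finite σ]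
    {p : MvPolynomial σ ℝ} {a : σ → ℝ} (h : ∀ᶠ x in nhds a, eval x p = 0) : p = 0 := by
  have := Fintype.ofFinite σ
  obtain ⟨ε, hε, hball⟩ := Metric.eventually_nhds_iff_ball.1 h
  refine funext_set (fun i => Metric.ball (a i) ε) (fun i => ?_) fun x hx => ?_
  · exact infinite_of_mem_nhds (a i) (Metric.ball_mem_nhds _ hε)
  · rw [map_zero]
    exact hball x (by rwa [ball_pi _ hε])

/-- The sign-changing criterion: an irreducible indefinite polynomial divides every polynomial
that vanishes on its real zeros. -/
theorem IsIndefinite.dvd_of_eval_eq_zero {n : ℕ} {h g : MvPolynomial (Fin n) ℝ}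
    (hind : IsIndefinite h) (hirr : Irreducible h)
    (hg : ∀ x, eval x h = 0 → eval x g = 0) : h ∣ g := by
  obtain ⟨⟨a, ha⟩, ⟨b, hb⟩⟩ := hind
  by_contra hndvd
  set v := b - a with hv
  have hb' : eval (a + v) h < 0 := by simpa [hv] using hb
  -- Along the line from `a` (`t = 0`) to `b` (`t = 1`), `h` changes sign, so it depends on `t`.
  have hdeg : (lineSubst v h).natDegree ≠ 0 := by
    intro hd
    obtain ⟨c, hc⟩ := Polynomial.natDegree_eq_zero.1 hd
    have h0 := eval_map_lineSubst v a 0 h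
    have h1 := eval_map_lineSubst v a 1 h
    rw [← hc] at h0 h1
    simp only [Polynomial.map_C, Polynomial.eval_C, zero_smul, add_zero, one_smul] at h0 h1
    linarith
  obtain ⟨p, q, r, hr, hpq⟩ := Polynomial.exists_mul_add_mul_eq_C
    (lineSubst_irreducible v hirr) hdeg (mt (lineSubst_dvd_iff v).1 hndvd)
  -- For `x` near `a`, `h` has a zero on the segment from `x` to `x + v`. There `g` vanishes too, so
  -- the Bézout identity gives `r(x) = 0`; hence `r = 0`.
  refine hr (MvPolynomial.eq_zero_of_eventually_eval_eq_zero (a := a) ?_)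
  have hpos : ∀ᶠ x in nhds a, 0 < eval x h :=
    (MvPolynomial.continuous_eval h).continuousAt.eventually (lt_mem_nhds ha)
  have hneg : ∀ᶠ x in nhds a, eval (x + v) h < 0 :=
    ((MvPolynomial.continuous_eval h).comp
      (continuous_id.add continuous_const)).continuousAt.eventually (gt_mem_nhds hb')
  filter_upwards [hpos, hneg] with x hx0 hx1
  have hcont : ContinuousOn (fun t : ℝ => eval (x + t • v) h) (Set.Icc 0 1) :=
    ((MvPolynomial.continuous_eval h).comp (by fun_prop)).continuousOn
  obtain ⟨t, -, ht⟩ := intermediate_value_Icc' zero_le_one hcont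
    (show (0 : ℝ) ∈ _ from ⟨by simpa using hx1.le, by simpa using hx0.le⟩)
  have heval := congrArg (fun P => (P.map (eval x)).eval t) hpq
  simpa [eval_map_lineSubst, show eval (x + t • v) h = 0 from ht, hg _ ht] using heval.symm

theorem irreducible_of_mem_forms_one {n : ℕ} {l : MvPolynomial (Fin n) ℝ} (hl : l ∈ Forms n 1)
    (h0 : l ≠ 0) : Irreducible l := by
  refine irreducible_of_totalDegree_eq_one (IsHomogeneous.totalDegree hl h0) fun x hx => ?_
  refine isUnit_iff_ne_zero.2 fun hx0 => h0 ?_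
  ext i
  simpa [hx0] using hx i

theorem MvPolynomial.IsHomogeneous.eval_smul {R σ : Type*} [CommSemiring R] [Fintype σ] {m : ℕ}
    {p : MvPolynomial σ R} (hp : p.IsHomogeneous m) (c : R) (x : σ → R) :
    eval (c • x) p = c ^ m * eval x p := by
  rw [eval_eq', eval_eq', Finset.mul_sum]
  refine Finset.sum_congr rfl fun e he => ?_
  have hdeg : ∑ i, e i = m := by
    rw [hp.degree_eq_sum_deg_support he, ← Finsupp.degree_apply, Finsupp.degree_eq_sum]
  simp only [Pi.smul_apply, smul_eq_mul, mul_pow, Finset.prod_mul_distrib,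
    Finset.prod_pow_eq_pow_sum, hdeg]
  ring

/-- Odd degree: `x ↦ -x` flips the sign. -/
theorem isIndefinite_of_mem_forms_one {n : ℕ} {l : MvPolynomial (Fin n) ℝ} (hl : l ∈ Forms n 1)
    (h0 : l ≠ 0) : IsIndefinite l := by
  obtain ⟨x, hx⟩ : ∃ x, eval x l ≠ 0 := by
    by_contra! hall
    exact h0 (MvPolynomial.funext fun x => by simpa using hall x)
  have hneg : eval ((-1 : ℝ) • x) l = -eval x l := by
    simpa using IsHomogeneous.eval_smul hl (-1 : ℝ) x
  rcases lt_or_gt_of_ne hx with hx | hx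
  · exact ⟨⟨_, by rw [hneg]; linarith⟩, ⟨x, hx⟩⟩
  · exact ⟨⟨x, hx⟩, ⟨_, by rw [hneg]; linarith⟩⟩

/-- An irreducible indefinite `h` divides every summand of a representation of a multiple of `h`
as a sum of squares. -/
theorem IsIndefinite.dvd_of_dvd_sum_sq {n : ℕ} {h : MvPolynomial (Fin n) ℝ}
    (hind : IsIndefinite h) (hirr : Irreducible h) {ι : Type*} [Fintype ι]
    {g : ι → MvPolynomial (Fin n) ℝ} (hsum : h ∣ ∑ j, g j ^ 2) (j : ι) : h ∣ g j := by
  refine hind.dvd_of_eval_eq_zero hirr fun x hx => ?_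
  obtain ⟨c, hc⟩ := hsum
  have hzero : ∑ j, eval x (g j) ^ 2 = 0 := by
    simpa [hx] using congrArg (eval x) hc
  exact pow_eq_zero_iff two_ne_zero |>.1
    ((Finset.sum_eq_zero_iff_of_nonneg fun i _ => sq_nonneg _).1 hzero j (Finset.mem_univ j))

/-- A product of irreducible indefinite polynomials divides every summand of a representation of
its square as a sum of squares. -/
theorem prod_dvd_of_sq_eq_sum_sq {n : ℕ} {ι : Type*} [Fintype ι] :
    ∀ {m : ℕ} {l : Fin m → MvPolynomial (Fin n) ℝ}
      (_ : ∀ i, IsIndefinite (l i) ∧ Irreducible (l i)) {g : ι → MvPolynomial (Fin n) ℝ}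
      (_ : (∏ i, l i) ^ 2 = ∑ j, g j ^ 2) (j : ι), ∏ i, l i ∣ g j
  | 0, _, _, _, _, _ => by simp
  | m + 1, l, hl, g, hsum, j => by
    rw [Fin.prod_univ_succ] at hsum ⊢
    have hdvd : ∀ j, l 0 ∣ g j := (hl 0).1.dvd_of_dvd_sum_sq (hl 0).2
      (hsum ▸ dvd_pow (dvd_mul_right _ _) two_ne_zero)
    choose g' hg' using hdvd
    have hsum' : (∏ i : Fin m, l i.succ) ^ 2 = ∑ j, g' j ^ 2 := by
      refine mul_left_cancel₀ (pow_ne_zero 2 (hl 0).2.ne_zero) ?_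
      rw [← mul_pow, hsum, Finset.mul_sum]
      exact Finset.sum_congr rfl fun j _ => by rw [hg' j, mul_pow]
    rw [hg' j]
    exact mul_dvd_mul_left _ (prod_dvd_of_sq_eq_sum_sq (fun i => hl i.succ) hsum' j)

/-- A form with fewer terms than `h` that is a multiple of the form `h` of the same degree is
zero. -/
theorem eq_zero_of_dvd_of_card_support_lt {n d : ℕ} {h g : MvPolynomial (Fin n) ℝ}
    (hh : h ∈ Forms n d) (hg : g ∈ Forms n d) (hdvd : h ∣ g)
    (hcard : g.support.card < h.support.card) : g = 0 := by
  by_contra hg0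
  obtain ⟨q, rfl⟩ := hdvd
  have hh0 := left_ne_zero_of_mul hg0
  have hq0 := right_ne_zero_of_mul hg0
  have hdeg := totalDegree_mul_of_isDomain hh0 hq0
  rw [IsHomogeneous.totalDegree hg hg0, IsHomogeneous.totalDegree hh hh0] at hdeg
  obtain ⟨c, rfl⟩ : ∃ c, q = C c := ⟨_, totalDegree_eq_zero_iff_eq_C.1 (by omega)⟩
  have hc : c ≠ 0 := fun hc => hq0 (by simp [hc])
  rw [mul_comm, ← smul_eq_C_mul, support_smul_eq hc] at hcard
  exact hcard.false

theorem corollary1p4 (n d k : ℕ) (hk : 1 ≤ k) (h : MvPolynomial (Fin n) ℝ)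
    (hh : h ∈ FormsAtMost n d k \ FormsAtMost n d (k - 1))
    (hcase : (IsIndefinite h ∧ Irreducible h) ∨ IsProductOfLinearForms h) :
    h ^ 2 ∈ SigmaCone n d k \ SigmaCone n d (k - 1) := by
  obtain ⟨hmem, hnot⟩ := hh
  have hcard : k - 1 < h.support.card := by
    by_contra! hle
    exact hnot ⟨hmem.1, hle⟩
  have hne : h ≠ 0 := by
    rintro rfl
    simp at hcard
  refine ⟨⟨1, fun _ => h, fun _ => hmem, by simp⟩, ?_⟩
  rintro ⟨m, g, hg, hsum⟩
  have hdvd : ∀ j, h ∣ g j := by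
    rcases hcase with ⟨hind, hirr⟩ | ⟨s, l, hl, rfl⟩
    · exact hind.dvd_of_dvd_sum_sq hirr (hsum ▸ dvd_pow_self h two_ne_zero)
    · have hl0 : ∀ i, l i ≠ 0 := fun i => Finset.prod_ne_zero_iff.1 hne i (Finset.mem_univ i)
      exact prod_dvd_of_sq_eq_sum_sq (fun i => ⟨isIndefinite_of_mem_forms_one (hl i) (hl0 i),
        irreducible_of_mem_forms_one (hl i) (hl0 i)⟩) hsum
  have hzero : ∀ j, g j = 0 := fun j =>
    eq_zero_of_dvd_of_card_support_lt hmem.1 (hg j).1 (hdvd j) ((hg j).2.trans_lt hcard)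
  exact hne (pow_eq_zero_iff two_ne_zero |>.1 (by simpa [hzero] using hsum))
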